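/- Let $\mathfrak c_4,\mathfrak c_5,\mathfrak c_6\in\mathbb C$, let $x(s)=\mathfrak c_4s^2+\mathfrak c_5s+\mathfrak c_6$ and $\beta=\mathfrak c_4/4$. On $\mathbb C[z]$ let $\mathrm D$ and $\mathrm S$ be the linear operators with $$\mathrm Dp(x(s))=\frac{p(x(s+\frac12))-p(x(s-\frac12))}{x(s+\frac12)-x(s-\frac12)},\qquad \mathrm Sp(x(s))=\frac{p(x(s+\frac12))+p(x(s-\frac12))}{2}$$ ($\mathrm Dp=p'$ and $\mathrm Sp=p$ if $x$ is constant). For a linear functional $\mathbf u:\mathbb C[z]\to\mathbb C$ and a polynomial $p$ put $\langle p\mathbf u,f\rangle=\langle\mathbf u,pf\rangle$, $\langle\mathbf D\mathbf u,f\rangle=-\langle\mathbf u,\mathrm Df\rangle$, $\langle\mathbf S\mathbf u,f\rangle=\langle\mathbf u,\mathrm Sf\rangle$. Let $(P_n)_{n\ge0}$ be a monic orthogonal polynomial sequence with respect to $\mathbf u$ (that is, $\deg P_n=n$, $\langle\mathbf u,P_nP_m\rangle=0$ for $n\ne m$, and $\langle\mathbf u,P_n^2\rangle\ne0$), with recurrence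 $P_{n+1}=(z-B_n)P_n-C_nP_{n-1}$, $P_{-1}=0$, $P_0=1$. Suppose that $\mathbf D(\phi\mathbf u)=\mathbf S(\psi\mathbf u)$ for some polynomials $\phi$ of degree at most two and $\psi(z)=dz+e$, not both zero. Then: 1. $d\neq0$, $C_1\ne0$ and $C_2\neq0$. 2. If $\phi,\psi$ are normalised so that $d=1$, then $\psi(z)=z-B_0$ and $\phi(z)=az^2+bz+c$ with $$a=\mathfrak a,\qquad b=-\mathfrak aB_0-\mathfrak b,\qquad c=\mathfrak bB_0-(\mathfrak a+1)C_1,$$ where $$\mathfrak a=-\frac13+\frac{(B_1-B_0)^2-8\beta(B_0+B_1-2\beta)+4(C_1+4\beta\mathfrak c_6)-\mathfrak c_5^2}{6C_2},\qquad \mathfrak b=(\mathfrak a+1)B_1+2\beta-\frac{B_0+B_1}2.$$ 3. If $d=1$, then $(a,b,c,e)=(\mathfrak a,\,-\mathfrak aB_0-\mathfrak b,\,\mathfrak bB_0-(\mathfrak a+1)C_1,\,-B_0)$ is the unique solution in $\mathbb C^4$ of the system $$B_0=-\frac{e_0}{d_0},\quad B_1=\frac{e_0}{d_0}-\frac{2e_1}{d_2},\quad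 C_1=-\frac1{d_1}\,\phi^{[0]}\!\Big(-\frac{e_0}{d_0}\Big),\quad C_2=-\frac{2d_0}{d_1d_3}\,\phi^{[1]}\!\Big(-\frac{\mathfrak c_4}4-\frac{e_1}{d_2}\Big)$$ with $d_0,d_1,d_2,d_3\ne0$, where $d_n=an+1$, $e_n=bn+e+\frac12\mathfrak c_4n^2$ and, with $\phi(z)=az^2+bz+c$ and $\psi(z)=z+e$, $$\phi^{[n]}(z)=az^2+\big(b+\tfrac32\mathfrak c_4nd_n\big)z+\phi\big(\tfrac14\mathfrak c_4n^2\big)+\tfrac12\mathfrak c_4n\,\psi\big(\tfrac14\mathfrak c_4n^2\big)-\tfrac n4\big(4\mathfrak c_4\mathfrak c_6-\mathfrak c_5^2\big)d_n.$$ -/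

import Mathlib

/-- The quadratic lattice `x(s) = c4 s² + c5 s + c6`. -/
def quadLattice (c4 c5 c6 s : ℂ) : ℂ := c4 * s ^ 2 + c5 * s + c6

/-- The constant `β = c4 / 4` of the quadratic lattice. -/
noncomputable def latticeBeta (c4 : ℂ) : ℂ := c4 / 4

/-- The polynomial `U` with `U(x(s)) = (x(s + 1/2) - x(s - 1/2))² / 4`
(see `eval_latticeU`). -/
noncomputable def latticeU (c4 c5 c6 : ℂ) : Polynomial ℂ :=
  Polynomial.C c4 * Polynomial.X + Polynomial.C (c5 ^ 2 / 4 - c4 * c6)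

/-- The pair `(D zⁿ, S zⁿ)`, computed by the product rules
`D(z f) = S f + (z + β) D f` and `S(z f) = U D f + (z + β) S f`. That these are the
`x`-derivative and the `x`-average of `zⁿ` is proved in `eval_xDeriv`, `eval_xAverage`
(and in `xDeriv_const`, `xAverage_const` for a constant lattice). -/
noncomputable def xPair (c4 c5 c6 : ℂ) : ℕ → Polynomial ℂ × Polynomial ℂ
  | 0 => (0, 1)
  | n + 1 =>
    ((xPair c4 c5 c6 n).2
        + (Polynomial.X + Polynomial.C (latticeBeta c4)) * (xPair c4 c5 c6 n).1,
      latticeU c4 c5 c6 * (xPair c4 c5 c6 n).1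
        + (Polynomial.X + Polynomial.C (latticeBeta c4)) * (xPair c4 c5 c6 n).2)

/-- The `x`-derivative `D` on polynomials, for the lattice `x(s) = c4 s² + c5 s + c6`:
`D p (x(s)) = (p(x(s+1/2)) - p(x(s-1/2))) / (x(s+1/2) - x(s-1/2))`, and `D p = p'` if the
lattice is constant. -/
noncomputable def xDeriv (c4 c5 c6 : ℂ) : Polynomial ℂ →ₗ[ℂ] Polynomial ℂ :=
  (Polynomial.basisMonomials ℂ).constr ℂ (fun n => (xPair c4 c5 c6 n).1)

/-- The `x`-average `S` on polynomials, for the lattice `x(s) = c4 s² + c5 s + c6`: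
`S p (x(s)) = (p(x(s+1/2)) + p(x(s-1/2))) / 2`. -/
noncomputable def xAverage (c4 c5 c6 : ℂ) : Polynomial ℂ →ₗ[ℂ] Polynomial ℂ :=
  (Polynomial.basisMonomials ℂ).constr ℂ (fun n => (xPair c4 c5 c6 n).2)

theorem xDeriv_monomial (c4 c5 c6 : ℂ) (n : ℕ) :
    xDeriv c4 c5 c6 (Polynomial.monomial n 1) = (xPair c4 c5 c6 n).1 := by
  have h := (Polynomial.basisMonomials ℂ).constr_basis ℂ (fun n => (xPair c4 c5 c6 n).1) n
  rwa [Polynomial.coe_basisMonomials] at h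

theorem xAverage_monomial (c4 c5 c6 : ℂ) (n : ℕ) :
    xAverage c4 c5 c6 (Polynomial.monomial n 1) = (xPair c4 c5 c6 n).2 := by
  have h := (Polynomial.basisMonomials ℂ).constr_basis ℂ (fun n => (xPair c4 c5 c6 n).2) n
  rwa [Polynomial.coe_basisMonomials] at h

theorem eval_latticeU (c4 c5 c6 s : ℂ) :
    (latticeU c4 c5 c6).eval (quadLattice c4 c5 c6 s) =
      (quadLattice c4 c5 c6 (s + 1 / 2) - quadLattice c4 c5 c6 (s - 1 / 2)) ^ 2 / 4 := by
  simp only [latticeU, quadLattice, Polynomial.eval_add, Polynomial.eval_mul,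
    Polynomial.eval_C, Polynomial.eval_X]
  ring

theorem eval_xPair (c4 c5 c6 s : ℂ) (n : ℕ) :
    ((xPair c4 c5 c6 n).1.eval (quadLattice c4 c5 c6 s)
        * (quadLattice c4 c5 c6 (s + 1 / 2) - quadLattice c4 c5 c6 (s - 1 / 2)) =
      quadLattice c4 c5 c6 (s + 1 / 2) ^ n - quadLattice c4 c5 c6 (s - 1 / 2) ^ n) ∧
    ((xPair c4 c5 c6 n).2.eval (quadLattice c4 c5 c6 s) =
      (quadLattice c4 c5 c6 (s + 1 / 2) ^ n + quadLattice c4 c5 c6 (s - 1 / 2) ^ n) / 2) := by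
  have hsum : quadLattice c4 c5 c6 s + latticeBeta c4 =
      (quadLattice c4 c5 c6 (s + 1 / 2) + quadLattice c4 c5 c6 (s - 1 / 2)) / 2 := by
    simp only [quadLattice, latticeBeta]; ring
  induction n with
  | zero => simp [xPair]
  | succ n ih =>
    obtain ⟨h1, h2⟩ := ih
    simp only [xPair, Polynomial.eval_add, Polynomial.eval_mul, Polynomial.eval_C,
      Polynomial.eval_X, eval_latticeU, hsum, h2]
    constructor
    · linear_combination
        ((quadLattice c4 c5 c6 (s + 1 / 2) + quadLattice c4 c5 c6 (s - 1 / 2)) / 2) * h1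
    · linear_combination
        ((quadLattice c4 c5 c6 (s + 1 / 2) - quadLattice c4 c5 c6 (s - 1 / 2)) / 4) * h1

/-- The defining property of the `x`-derivative. -/
theorem eval_xDeriv (c4 c5 c6 s : ℂ) (p : Polynomial ℂ) :
    (xDeriv c4 c5 c6 p).eval (quadLattice c4 c5 c6 s)
        * (quadLattice c4 c5 c6 (s + 1 / 2) - quadLattice c4 c5 c6 (s - 1 / 2)) =
      p.eval (quadLattice c4 c5 c6 (s + 1 / 2)) - p.eval (quadLattice c4 c5 c6 (s - 1 / 2)) := by
  induction p using Polynomial.induction_on' with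
  | add p q hp hq =>
    simp only [map_add, Polynomial.eval_add]
    linear_combination hp + hq
  | monomial n a =>
    have h : Polynomial.monomial n a = a • Polynomial.monomial n (1 : ℂ) := by
      simp [Polynomial.smul_monomial]
    rw [h, map_smul, xDeriv_monomial]
    simp only [Polynomial.eval_smul, Polynomial.eval_monomial, smul_eq_mul, one_mul]
    linear_combination a * (eval_xPair c4 c5 c6 s n).1

/-- The defining property of the `x`-average. -/
theorem eval_xAverage (c4 c5 c6 s : ℂ) (p : Polynomial ℂ) :
    (xAverage c4 c5 c6 p).eval (quadLattice c4 c5 c6 s) =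
      (p.eval (quadLattice c4 c5 c6 (s + 1 / 2))
        + p.eval (quadLattice c4 c5 c6 (s - 1 / 2))) / 2 := by
  induction p using Polynomial.induction_on' with
  | add p q hp hq =>
    simp only [map_add, Polynomial.eval_add]
    linear_combination hp + hq
  | monomial n a =>
    have h : Polynomial.monomial n a = a • Polynomial.monomial n (1 : ℂ) := by
      simp [Polynomial.smul_monomial]
    rw [h, map_smul, xAverage_monomial]
    simp only [Polynomial.eval_smul, Polynomial.eval_monomial, smul_eq_mul, one_mul]
    linear_combination a * (eval_xPair c4 c5 c6 s n).2

theorem xPair_const (c6 : ℂ) (n : ℕ) :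
    xPair 0 0 c6 n = (Polynomial.derivative (Polynomial.X ^ n), Polynomial.X ^ n) := by
  induction n with
  | zero => simp [xPair]
  | succ n ih =>
    simp only [xPair, ih, latticeU, latticeBeta]
    ext1
    · simp only [pow_succ, Polynomial.derivative_mul, Polynomial.derivative_X]
      simp only [zero_div, map_zero]
      ring
    · simp only [pow_succ]
      simp
      ring

/-- On a constant lattice the `x`-derivative is the usual derivative. -/
theorem xDeriv_const (c6 : ℂ) (p : Polynomial ℂ) :
    xDeriv 0 0 c6 p = Polynomial.derivative p := by
  induction p using Polynomial.induction_on' with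
  | add p q hp hq => simp only [map_add, hp, hq]
  | monomial n a =>
    have h : Polynomial.monomial n a = a • Polynomial.monomial n (1 : ℂ) := by
      simp [Polynomial.smul_monomial]
    rw [h, map_smul, xDeriv_monomial, xPair_const, Polynomial.derivative_smul,
      Polynomial.monomial_one_right_eq_X_pow]

/-- On a constant lattice the `x`-average is the identity. -/
theorem xAverage_const (c6 : ℂ) (p : Polynomial ℂ) : xAverage 0 0 c6 p = p := by
  induction p using Polynomial.induction_on' with
  | add p q hp hq => simp only [map_add, hp, hq]
  | monomial n a =>
    have h : Polynomial.monomial n a = a • Polynomial.monomial n (1 : ℂ) := by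
      simp [Polynomial.smul_monomial]
    rw [h, map_smul, xAverage_monomial, xPair_const,
      Polynomial.monomial_one_right_eq_X_pow]

/-- The functional `p u`: `⟨p u, f⟩ = ⟨u, p f⟩`. -/
noncomputable def polyMulFunctional (p : Polynomial ℂ) (u : Polynomial ℂ →ₗ[ℂ] ℂ) :
    Polynomial ℂ →ₗ[ℂ] ℂ :=
  u ∘ₗ LinearMap.mulLeft ℂ p

/-- The functional `D u`: `⟨D u, f⟩ = -⟨u, D f⟩`. -/
noncomputable def functionalDeriv (c4 c5 c6 : ℂ) (u : Polynomial ℂ →ₗ[ℂ] ℂ) :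
    Polynomial ℂ →ₗ[ℂ] ℂ :=
  -(u ∘ₗ xDeriv c4 c5 c6)

/-- The functional `S u`: `⟨S u, f⟩ = ⟨u, S f⟩`. -/
noncomputable def functionalAverage (c4 c5 c6 : ℂ) (u : Polynomial ℂ →ₗ[ℂ] ℂ) :
    Polynomial ℂ →ₗ[ℂ] ℂ :=
  u ∘ₗ xAverage c4 c5 c6

/-- `P` is a monic orthogonal polynomial sequence with respect to `u`. -/
structure IsMonicOPS (u : Polynomial ℂ →ₗ[ℂ] ℂ) (P : ℕ → Polynomial ℂ) : Prop where
  monic : ∀ n, (P n).Monic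
  natDegree_eq : ∀ n, (P n).natDegree = n
  orthogonal : ∀ n m, n ≠ m → u (P n * P m) = 0
  norm_ne_zero : ∀ n, u (P n * P n) ≠ 0

/-- `B n` (`n ≥ 0`) and `C n` (`n ≥ 1`) are the coefficients of the three-term recurrence
`P_{n+1} = (z - B_n) P_n - C_n P_{n-1}`, `P_{-1} = 0`, `P_0 = 1`. -/
structure HasRecurrenceCoeffs (P : ℕ → Polynomial ℂ) (B C : ℕ → ℂ) : Prop where
  zero : P 0 = 1
  one : P 1 = Polynomial.X - Polynomial.C (B 0)
  step : ∀ n, P (n + 2) =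
    (Polynomial.X - Polynomial.C (B (n + 1))) * P (n + 1) - Polynomial.C (C (n + 1)) * P n

/-- The Pearson equation `D(φ u) = S(ψ u)` with `deg φ ≤ 2`, `deg ψ ≤ 1` and `φ`, `ψ` not both
zero. -/
structure SatisfiesPearson (c4 c5 c6 : ℂ) (u : Polynomial ℂ →ₗ[ℂ] ℂ) (φ ψ : Polynomial ℂ) :
    Prop where
  degree_phi : φ.natDegree ≤ 2
  degree_psi : ψ.natDegree ≤ 1
  nontrivial : φ ≠ 0 ∨ ψ ≠ 0
  pearson : functionalDeriv c4 c5 c6 (polyMulFunctional φ u) =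
    functionalAverage c4 c5 c6 (polyMulFunctional ψ u)

/-- `d_n = a n + d`. -/
noncomputable def dSeq (a d : ℂ) (n : ℕ) : ℂ := a * n + d

/-- `e_n = b n + e + c4 d n² / 2`. -/
noncomputable def eSeq (c4 b d e : ℂ) (n : ℕ) : ℂ := b * n + e + 1 / 2 * c4 * d * (n : ℂ) ^ 2

/-- The polynomial `φ^{[n]}`, for `φ(z) = a z² + b z + c` and `ψ(z) = d z + e`, evaluated
at `z`. -/
noncomputable def phiBracket (c4 c5 c6 a b c d e : ℂ) (n : ℕ) (z : ℂ) : ℂ :=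
  a * z ^ 2 + (b + 3 / 2 * c4 * n * dSeq a d n) * z
    + (a * (c4 * (n : ℂ) ^ 2 / 4) ^ 2 + b * (c4 * (n : ℂ) ^ 2 / 4) + c)
    + 1 / 2 * c4 * n * (d * (c4 * (n : ℂ) ^ 2 / 4) + e)
    - n / 4 * (4 * c4 * c6 - c5 ^ 2) * dSeq a d n

/-- The explicit formulas
`B_n = n e_{n-1} / d_{2n-2} - (n+1) e_n / d_{2n} - c4 n (n-1) / 2` and
`C_{n+1} = -(n+1) d_{n-1} / (d_{2n-1} d_{2n+1}) φ^{[n]}(-c4 n² / 4 - e_n / d_{2n})`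
at `n = 0` and `n = 1`. For `n = 0` the factor `d_{n-1} / d_{2n-1}` is read as `1`. -/
structure FirstRecurrenceSystem (c4 c5 c6 a b c d e B0 B1 C1 C2 : ℂ) : Prop where
  d_ne_zero : ∀ n ≤ 3, dSeq a d n ≠ 0
  B0_eq : B0 = -(eSeq c4 b d e 0 / dSeq a d 0)
  B1_eq : B1 = eSeq c4 b d e 0 / dSeq a d 0 - 2 * eSeq c4 b d e 1 / dSeq a d 2
  C1_eq : C1 = -(1 / dSeq a d 1) *
    phiBracket c4 c5 c6 a b c d e 0 (-(eSeq c4 b d e 0 / dSeq a d 0))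
  C2_eq : C2 = -(2 * dSeq a d 0 / (dSeq a d 1 * dSeq a d 3)) *
    phiBracket c4 c5 c6 a b c d e 1 (-(c4 / 4) - eSeq c4 b d e 1 / dSeq a d 2)

/-- The constant `𝔞`, as a function of `B₀, B₁, C₁, C₂` and the lattice. -/
noncomputable def fraka (c4 c5 c6 B0 B1 C1 C2 : ℂ) : ℂ :=
  -1 / 3 + ((B1 - B0) ^ 2 - 8 * latticeBeta c4 * (B0 + B1 - 2 * latticeBeta c4)
    + 4 * (C1 + 4 * latticeBeta c4 * c6) - c5 ^ 2) / (6 * C2)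

/-- The constant `𝔟`, as a function of `B₀, B₁, C₁, C₂` and the lattice. -/
noncomputable def frakb (c4 c5 c6 B0 B1 C1 C2 : ℂ) : ℂ :=
  (fraka c4 c5 c6 B0 B1 C1 C2 + 1) * B1 + 2 * latticeBeta c4 - (B0 + B1) / 2

/-! ### The operators `D` and `S` -/

/-! Tested on a polynomial f, the Pearson equation says u(φ·Df + ψ·Sf) = 0. Since D lowers the
degree by one and is surjective, and u is nondegenerate, d = 0 forces ψ = 0 and then φ = 0. The
nonvanishing of C₁ and C₂ is the positivity-free form of u(Pₙ₊₁²) = Cₙ₊₁ u(Pₙ²).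

The monomials 1, z, z², z³ as test functions give four equations in the moments up to order four,
hence in B₀, B₁, C₁, C₂. With d = 1 they are triangular: they yield e, then c in terms of a and b,
then b after division by C₁, then a after division by C₁C₂ (`SatisfiesPearson.coeffs_eq`).

The explicit system has the same triangular shape (`firstRecurrenceSystem_iff`), but for these
values to solve it, dₙ ≠ 0 is needed (`SatisfiesPearson.dSeq_ne_zero`). The operator L = φD² + ψSD
is symmetric for u, because f·Lg − g·Lf = φ·DW + ψ·SW for the Casoratian W of f and g. It multiplies
the leading coefficient in degree n+1 by (n+1)dₙ. If dₙ = 0, symmetry gives L Pₙ₊₁ = 0, and a second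
relation for g = D Pₙ₊₁ follows from the Pearson equation. Eliminating Dg gives φ² = Uψ², impossible
since deg U ≤ 1 while a ≠ 0. -/

/-- As U has degree at most one, U·D zⁿ does not reach degree n+1 in the recursion for S.
Multiplying by X in the last clause avoids the index n − 1, so that n = 0 is included. -/
theorem coeff_xPair (c4 c5 c6 : ℂ) (n : ℕ) :
    (∀ k, n < k → (xPair c4 c5 c6 n).2.coeff k = 0) ∧ (xPair c4 c5 c6 n).2.coeff n = 1 ∧
    (∀ k, n ≤ k → (xPair c4 c5 c6 n).1.coeff k = 0) ∧
    (Polynomial.X * (xPair c4 c5 c6 n).1).coeff n = (n : ℂ) := by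
  induction n with
  | zero =>
    refine ⟨fun k hk => ?_, by simp [xPair], by simp [xPair], by simp [xPair]⟩
    simp [xPair, Polynomial.coeff_one, hk.ne']
  | succ n ih =>
    obtain ⟨h1, h2, h3, h4⟩ := ih
    refine ⟨fun k hk => ?_, ?_, fun k hk => ?_, ?_⟩
    · obtain ⟨k, rfl⟩ : ∃ j, k = j + 1 := ⟨k - 1, by omega⟩
      have a1 := h1 k (by omega)
      have a2 := h1 (k + 1) (by omega)
      have a3 := h3 k (by omega)
      have a4 := h3 (k + 1) (by omega)
      simp only [xPair, latticeU, add_mul, mul_assoc, Polynomial.coeff_add, Polynomial.coeff_C_mul,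
        Polynomial.coeff_X_mul, a1, a2, a3, a4, mul_zero, add_zero]
    · have a2 := h1 (n + 1) (by omega)
      have a3 := h3 n le_rfl
      have a4 := h3 (n + 1) (by omega)
      simp only [xPair, latticeU, add_mul, mul_assoc, Polynomial.coeff_add, Polynomial.coeff_C_mul,
        Polynomial.coeff_X_mul, h2, a2, a3, a4, mul_zero, add_zero, zero_add]
    · obtain ⟨k, rfl⟩ : ∃ j, k = j + 1 := ⟨k - 1, by omega⟩
      have a2 := h1 (k + 1) (by omega)
      have a3 := h3 k (by omega)
      have a4 := h3 (k + 1) (by omega)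
      simp only [xPair, add_mul, Polynomial.coeff_add, Polynomial.coeff_C_mul,
        Polynomial.coeff_X_mul, a2, a3, a4, mul_zero, add_zero]
    · have a3 := h3 n le_rfl
      simp only [xPair, Polynomial.coeff_X_mul, add_mul, Polynomial.coeff_add,
        Polynomial.coeff_C_mul, h2, h4, a3, mul_zero, add_zero]
      push_cast
      ring

theorem xDeriv_eq_sum (c4 c5 c6 : ℂ) {p : Polynomial ℂ} {n : ℕ} (hp : p.natDegree ≤ n) :
    xDeriv c4 c5 c6 p = ∑ i ∈ Finset.range (n + 1), p.coeff i • (xPair c4 c5 c6 i).1 := by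
  conv_lhs => rw [p.as_sum_range' (n + 1) (by omega)]
  rw [map_sum]
  refine Finset.sum_congr rfl fun i _ => ?_
  rw [← xDeriv_monomial, ← map_smul, Polynomial.smul_monomial, smul_eq_mul, mul_one]

theorem xAverage_eq_sum (c4 c5 c6 : ℂ) {p : Polynomial ℂ} {n : ℕ} (hp : p.natDegree ≤ n) :
    xAverage c4 c5 c6 p = ∑ i ∈ Finset.range (n + 1), p.coeff i • (xPair c4 c5 c6 i).2 := by
  conv_lhs => rw [p.as_sum_range' (n + 1) (by omega)]
  rw [map_sum]
  refine Finset.sum_congr rfl fun i _ => ?_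
  rw [← xAverage_monomial, ← map_smul, Polynomial.smul_monomial, smul_eq_mul, mul_one]

theorem natDegree_xAverage_le (c4 c5 c6 : ℂ) {p : Polynomial ℂ} {n : ℕ} (hp : p.natDegree ≤ n) :
    (xAverage c4 c5 c6 p).natDegree ≤ n := by
  rw [Polynomial.natDegree_le_iff_coeff_eq_zero]
  intro k hk
  rw [xAverage_eq_sum c4 c5 c6 hp, Polynomial.finsetSum_coeff]
  refine Finset.sum_eq_zero fun i hi => ?_
  rw [Finset.mem_range] at hi
  rw [Polynomial.coeff_smul, (coeff_xPair c4 c5 c6 i).1 k (by omega), smul_zero]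

theorem coeff_xAverage (c4 c5 c6 : ℂ) {p : Polynomial ℂ} {n : ℕ} (hp : p.natDegree ≤ n) :
    (xAverage c4 c5 c6 p).coeff n = p.coeff n := by
  rw [xAverage_eq_sum c4 c5 c6 hp, Polynomial.finsetSum_coeff, Finset.sum_range_succ,
    Finset.sum_eq_zero, Polynomial.coeff_smul, (coeff_xPair c4 c5 c6 n).2.1]
  · simp
  · intro i hi
    rw [Finset.mem_range] at hi
    rw [Polynomial.coeff_smul, (coeff_xPair c4 c5 c6 i).1 n hi, smul_zero]

theorem coeff_xDeriv_eq_zero (c4 c5 c6 : ℂ) {p : Polynomial ℂ} {n k : ℕ}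
    (hp : p.natDegree ≤ n) (hk : n ≤ k) : (xDeriv c4 c5 c6 p).coeff k = 0 := by
  rw [xDeriv_eq_sum c4 c5 c6 hp, Polynomial.finsetSum_coeff]
  refine Finset.sum_eq_zero fun i hi => ?_
  rw [Finset.mem_range] at hi
  rw [Polynomial.coeff_smul, (coeff_xPair c4 c5 c6 i).2.2.1 k (by omega), smul_zero]

theorem natDegree_xDeriv_le (c4 c5 c6 : ℂ) {p : Polynomial ℂ} {n : ℕ}
    (hp : p.natDegree ≤ n + 1) : (xDeriv c4 c5 c6 p).natDegree ≤ n := by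
  rw [Polynomial.natDegree_le_iff_coeff_eq_zero]
  exact fun k hk => coeff_xDeriv_eq_zero c4 c5 c6 hp hk

theorem coeff_xDeriv (c4 c5 c6 : ℂ) {p : Polynomial ℂ} {n : ℕ} (hp : p.natDegree ≤ n + 1) :
    (xDeriv c4 c5 c6 p).coeff n = (n + 1) * p.coeff (n + 1) := by
  have h := (coeff_xPair c4 c5 c6 (n + 1)).2.2.2
  rw [Polynomial.coeff_X_mul] at h
  rw [xDeriv_eq_sum c4 c5 c6 hp, Polynomial.finsetSum_coeff, Finset.sum_range_succ,
    Finset.sum_eq_zero, Polynomial.coeff_smul, h]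
  · push_cast
    simp [mul_comm]
  · intro i hi
    rw [Finset.mem_range] at hi
    rw [Polynomial.coeff_smul, (coeff_xPair c4 c5 c6 i).2.2.1 n (by omega), smul_zero]

/-- D zⁿ⁺¹ has leading term (n+1)zⁿ with n+1 ≠ 0, so leading terms can be removed one at a time. The
strict bound on `degree` makes q = 0 the base case. -/
theorem xDeriv_surjective (c4 c5 c6 : ℂ) : Function.Surjective (xDeriv c4 c5 c6) := by
  have key : ∀ n : ℕ, ∀ q : Polynomial ℂ, q.degree < n → ∃ p, xDeriv c4 c5 c6 p = q := by
    intro n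
    induction n with
    | zero =>
      intro q hq
      refine ⟨0, ?_⟩
      rw [map_zero, eq_comm]
      simpa [Polynomial.degree_lt_iff_coeff_zero, Polynomial.ext_iff] using hq
    | succ n ih =>
      intro q hq
      set m : Polynomial ℂ := Polynomial.monomial (n + 1) (q.coeff n / (n + 1)) with hm
      have hmd : m.natDegree ≤ n + 1 := Polynomial.natDegree_monomial_le _
      obtain ⟨p, hp⟩ := ih (q - xDeriv c4 c5 c6 m) (by
        rw [Polynomial.degree_lt_iff_coeff_zero] at hq ⊢
        intro k hk
        rw [Polynomial.coeff_sub]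
        rcases hk.eq_or_lt with rfl | hk
        · rw [coeff_xDeriv c4 c5 c6 hmd, hm, Polynomial.coeff_monomial, if_pos rfl,
            mul_div_cancel₀ _ (Nat.cast_add_one_ne_zero n), sub_self]
        · rw [hq k (by exact_mod_cast hk), coeff_xDeriv_eq_zero c4 c5 c6 hmd hk, sub_zero])
      exact ⟨p + m, by rw [map_add, hp, sub_add_cancel]⟩
  intro q
  exact key (q.natDegree + 1) q (lt_of_le_of_lt Polynomial.degree_le_natDegree (by
    exact_mod_cast Nat.lt_succ_self _))

/-! ### Product rules and the Casoratian -/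

/-- The step x(s+½) − x(s−½) = 2c₄s + c₅ is a nonzero polynomial in s, and composition with the
nonconstant x is injective. Keeping the step as a factor lets `eval_xDeriv` be used without
division. Constant lattices have step zero and are treated separately throughout. -/
theorem eq_of_eval_quadLattice {c4 c5 c6 : ℂ} (h : c4 ≠ 0 ∨ c5 ≠ 0) {p q : Polynomial ℂ}
    (hpq : ∀ s, p.eval (quadLattice c4 c5 c6 s)
        * (quadLattice c4 c5 c6 (s + 1 / 2) - quadLattice c4 c5 c6 (s - 1 / 2)) =
      q.eval (quadLattice c4 c5 c6 s)
        * (quadLattice c4 c5 c6 (s + 1 / 2) - quadLattice c4 c5 c6 (s - 1 / 2))) : p = q := by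
  set r : Polynomial ℂ := Polynomial.C c4 * Polynomial.X ^ 2 + Polynomial.C c5 * Polynomial.X
    + Polynomial.C c6 with hr
  set δ : Polynomial ℂ := Polynomial.C (2 * c4) * Polynomial.X + Polynomial.C c5 with hδ
  have hr' (s : ℂ) : r.eval s = quadLattice c4 c5 c6 s := by simp [hr, quadLattice]
  have h0 : (p - q).comp r * δ = 0 := by
    refine Polynomial.funext fun s => ?_
    have := hpq s
    simp only [Polynomial.eval_mul, Polynomial.eval_comp, hr', Polynomial.eval_sub,
      Polynomial.eval_zero]
    have hd : δ.eval s =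
        quadLattice c4 c5 c6 (s + 1 / 2) - quadLattice c4 c5 c6 (s - 1 / 2) := by
      simp only [hδ, quadLattice, Polynomial.eval_add, Polynomial.eval_mul, Polynomial.eval_C,
        Polynomial.eval_X]
      ring
    rw [hd]
    linear_combination this
  have hδ0 : δ ≠ 0 := by
    intro h0
    have e0 := congrArg (fun t => Polynomial.coeff t 0) h0
    have e1 := congrArg (fun t => Polynomial.coeff t 1) h0
    simp [hδ, Polynomial.coeff_C] at e0 e1
    exact h.elim (fun h => h e1) (fun h => h e0)
  have hc := (mul_eq_zero.1 h0).resolve_right hδ0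
  rcases Polynomial.comp_eq_zero_iff.1 hc with hc | ⟨-, hc⟩
  · exact sub_eq_zero.1 hc
  · exfalso
    have e1 := congrArg (fun t => Polynomial.coeff t 1) hc
    have e2 := congrArg (fun t => Polynomial.coeff t 2) hc
    simp [hr, Polynomial.coeff_X, Polynomial.coeff_C] at e1 e2
    exact h.elim (fun h => h e2) (fun h => h e1)

theorem xDeriv_mul (c4 c5 c6 : ℂ) (f g : Polynomial ℂ) :
    xDeriv c4 c5 c6 (f * g) = xDeriv c4 c5 c6 f * xAverage c4 c5 c6 g
      + xAverage c4 c5 c6 f * xDeriv c4 c5 c6 g := by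
  by_cases h : c4 ≠ 0 ∨ c5 ≠ 0
  · refine eq_of_eval_quadLattice (c6 := c6) h fun s => ?_
    have hf := eval_xDeriv c4 c5 c6 s f
    have hg := eval_xDeriv c4 c5 c6 s g
    simp only [eval_xDeriv, Polynomial.eval_add, Polynomial.eval_mul, eval_xAverage]
    linear_combination
      -((g.eval (quadLattice c4 c5 c6 (s + 1 / 2))
        + g.eval (quadLattice c4 c5 c6 (s - 1 / 2))) / 2) * hf
      - ((f.eval (quadLattice c4 c5 c6 (s + 1 / 2))
        + f.eval (quadLattice c4 c5 c6 (s - 1 / 2))) / 2) * hg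
  · obtain ⟨rfl, rfl⟩ := not_or.1 h |>.imp not_not.1 not_not.1
    simp only [xDeriv_const, xAverage_const, Polynomial.derivative_mul]

theorem xAverage_mul (c4 c5 c6 : ℂ) (f g : Polynomial ℂ) :
    xAverage c4 c5 c6 (f * g) = latticeU c4 c5 c6 * xDeriv c4 c5 c6 f * xDeriv c4 c5 c6 g
      + xAverage c4 c5 c6 f * xAverage c4 c5 c6 g := by
  by_cases h : c4 ≠ 0 ∨ c5 ≠ 0
  · refine eq_of_eval_quadLattice (c6 := c6) h fun s => ?_
    congr 1
    have hf := eval_xDeriv c4 c5 c6 s f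
    have hg := eval_xDeriv c4 c5 c6 s g
    simp only [Polynomial.eval_add, Polynomial.eval_mul, eval_xAverage, eval_latticeU]
    have := congrArg₂ (· * ·) hf hg
    linear_combination -(1 / 4) * this
  · obtain ⟨rfl, rfl⟩ := not_or.1 h |>.imp not_not.1 not_not.1
    simp [xAverage_const, latticeU]

/-- The Casoratian `S f · D g - S g · D f` of two polynomials on the lattice. -/
noncomputable def xCasoratian (c4 c5 c6 : ℂ) (f g : Polynomial ℂ) : Polynomial ℂ :=
  xAverage c4 c5 c6 f * xDeriv c4 c5 c6 g - xAverage c4 c5 c6 g * xDeriv c4 c5 c6 f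

/-- At x(s+½) the average Sf is f(x(s)) plus half the step times Df, and the corrections cancel in
the antisymmetric combination. Both half-shifts thus involve the same values f(x(s)) and g(x(s)),
which factor out of DW and SW. -/
theorem eval_xCasoratian_add_half (c4 c5 c6 s : ℂ) (f g : Polynomial ℂ) :
    (xCasoratian c4 c5 c6 f g).eval (quadLattice c4 c5 c6 (s + 1 / 2)) =
      f.eval (quadLattice c4 c5 c6 s)
          * (xDeriv c4 c5 c6 g).eval (quadLattice c4 c5 c6 (s + 1 / 2))
        - g.eval (quadLattice c4 c5 c6 s)
          * (xDeriv c4 c5 c6 f).eval (quadLattice c4 c5 c6 (s + 1 / 2)) := by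
  have hf := eval_xDeriv c4 c5 c6 (s + 1 / 2) f
  have hg := eval_xDeriv c4 c5 c6 (s + 1 / 2) g
  simp only [xCasoratian, Polynomial.eval_sub, Polynomial.eval_mul, eval_xAverage]
  simp only [add_sub_cancel_right] at hf hg ⊢
  linear_combination
    (1 / 2) * (xDeriv c4 c5 c6 f).eval (quadLattice c4 c5 c6 (s + 1 / 2)) * hg
    - (1 / 2) * (xDeriv c4 c5 c6 g).eval (quadLattice c4 c5 c6 (s + 1 / 2)) * hf

theorem eval_xCasoratian_sub_half (c4 c5 c6 s : ℂ) (f g : Polynomial ℂ) :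
    (xCasoratian c4 c5 c6 f g).eval (quadLattice c4 c5 c6 (s - 1 / 2)) =
      f.eval (quadLattice c4 c5 c6 s)
          * (xDeriv c4 c5 c6 g).eval (quadLattice c4 c5 c6 (s - 1 / 2))
        - g.eval (quadLattice c4 c5 c6 s)
          * (xDeriv c4 c5 c6 f).eval (quadLattice c4 c5 c6 (s - 1 / 2)) := by
  have hf := eval_xDeriv c4 c5 c6 (s - 1 / 2) f
  have hg := eval_xDeriv c4 c5 c6 (s - 1 / 2) g
  simp only [xCasoratian, Polynomial.eval_sub, Polynomial.eval_mul, eval_xAverage]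
  simp only [sub_add_cancel] at hf hg ⊢
  linear_combination
    -(1 / 2) * (xDeriv c4 c5 c6 f).eval (quadLattice c4 c5 c6 (s - 1 / 2)) * hg
    + (1 / 2) * (xDeriv c4 c5 c6 g).eval (quadLattice c4 c5 c6 (s - 1 / 2)) * hf

theorem xDeriv_xCasoratian (c4 c5 c6 : ℂ) (f g : Polynomial ℂ) :
    xDeriv c4 c5 c6 (xCasoratian c4 c5 c6 f g) =
      f * xDeriv c4 c5 c6 (xDeriv c4 c5 c6 g) - g * xDeriv c4 c5 c6 (xDeriv c4 c5 c6 f) := by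
  by_cases h : c4 ≠ 0 ∨ c5 ≠ 0
  · refine eq_of_eval_quadLattice (c6 := c6) h fun s => ?_
    have hf := eval_xDeriv c4 c5 c6 s (xDeriv c4 c5 c6 f)
    have hg := eval_xDeriv c4 c5 c6 s (xDeriv c4 c5 c6 g)
    rw [eval_xDeriv, eval_xCasoratian_add_half, eval_xCasoratian_sub_half]
    simp only [Polynomial.eval_sub, Polynomial.eval_mul]
    linear_combination g.eval (quadLattice c4 c5 c6 s) * hf
      - f.eval (quadLattice c4 c5 c6 s) * hg
  · obtain ⟨rfl, rfl⟩ := not_or.1 h |>.imp not_not.1 not_not.1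
    simp only [xCasoratian, xDeriv_const, xAverage_const, Polynomial.derivative_mul,
      Polynomial.derivative_sub]
    ring

theorem xAverage_xCasoratian (c4 c5 c6 : ℂ) (f g : Polynomial ℂ) :
    xAverage c4 c5 c6 (xCasoratian c4 c5 c6 f g) =
      f * xAverage c4 c5 c6 (xDeriv c4 c5 c6 g) - g * xAverage c4 c5 c6 (xDeriv c4 c5 c6 f) := by
  by_cases h : c4 ≠ 0 ∨ c5 ≠ 0
  · refine eq_of_eval_quadLattice (c6 := c6) h fun s => ?_
    congr 1
    rw [eval_xAverage, eval_xCasoratian_add_half, eval_xCasoratian_sub_half]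
    simp only [Polynomial.eval_sub, Polynomial.eval_mul, eval_xAverage]
    ring
  · obtain ⟨rfl, rfl⟩ := not_or.1 h |>.imp not_not.1 not_not.1
    simp only [xCasoratian, xDeriv_const, xAverage_const]

/-! ### Regular functionals -/

theorem IsMonicOPS.apply_mul_eq_zero {u : Polynomial ℂ →ₗ[ℂ] ℂ} {P : ℕ → Polynomial ℂ}
    (hP : IsMonicOPS u P) {n : ℕ} {q : Polynomial ℂ} (hq : q.degree < n) : u (q * P n) = 0 := by
  have key : ∀ k : ℕ, k ≤ n → ∀ q : Polynomial ℂ, q.degree < k → u (q * P n) = 0 := by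
    intro k
    induction k with
    | zero =>
      intro _ q hq
      have : q = 0 := by
        simpa [Polynomial.degree_lt_iff_coeff_zero, Polynomial.ext_iff] using hq
      rw [this, zero_mul, map_zero]
    | succ k ih =>
      intro hk q hq
      have h1 : u ((q - q.coeff k • P k) * P n) = 0 := by
        refine ih (by omega) _ ?_
        rw [Polynomial.degree_lt_iff_coeff_zero] at hq ⊢
        intro j hj
        rw [Polynomial.coeff_sub, Polynomial.coeff_smul]
        rcases hj.eq_or_lt with rfl | hj
        · have := (hP.monic k).coeff_natDegree
          rw [hP.natDegree_eq] at this
          rw [this, smul_eq_mul, mul_one, sub_self]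
        · rw [hq j (by exact_mod_cast hj),
            Polynomial.coeff_eq_zero_of_natDegree_lt (p := P k) (by rwa [hP.natDegree_eq]), smul_zero,
            sub_zero]
      rw [sub_mul, map_sub, smul_mul_assoc, map_smul, hP.orthogonal k n (by omega), smul_zero,
        sub_zero] at h1
      exact h1
  exact key n le_rfl q hq

theorem IsMonicOPS.apply_mul_natDegree {u : Polynomial ℂ →ₗ[ℂ] ℂ} {P : ℕ → Polynomial ℂ}
    (hP : IsMonicOPS u P) {n : ℕ} {q : Polynomial ℂ} (hq : q.natDegree ≤ n) :
    u (q * P n) = q.coeff n * u (P n * P n) := by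
  have h : u ((q - q.coeff n • P n) * P n) = 0 := by
    refine hP.apply_mul_eq_zero ?_
    rw [Polynomial.degree_lt_iff_coeff_zero]
    intro j hj
    rw [Polynomial.coeff_sub, Polynomial.coeff_smul]
    rcases hj.eq_or_lt with rfl | hj
    · have := (hP.monic n).coeff_natDegree
      rw [hP.natDegree_eq] at this
      rw [this, smul_eq_mul, mul_one, sub_self]
    · rw [Polynomial.coeff_eq_zero_of_natDegree_lt (hq.trans_lt hj),
        Polynomial.coeff_eq_zero_of_natDegree_lt (p := P n) (by rwa [hP.natDegree_eq]), smul_zero, sub_zero]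
  rw [sub_mul, map_sub, smul_mul_assoc, map_smul, smul_eq_mul] at h
  linear_combination h

/-- The single test f = Pₙ with n = deg q returns the leading coefficient of q times a nonzero norm.
The degree bound on f matters in `SatisfiesPearson.dSeq_ne_zero`, where only such f are controlled.
-/
theorem IsMonicOPS.eq_zero_of_forall {u : Polynomial ℂ →ₗ[ℂ] ℂ} {P : ℕ → Polynomial ℂ}
    (hP : IsMonicOPS u P) {q : Polynomial ℂ}
    (hq : ∀ f : Polynomial ℂ, f.natDegree ≤ q.natDegree → u (q * f) = 0) : q = 0 := by
  have h := hq (P q.natDegree) (hP.natDegree_eq _).le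
  rw [hP.apply_mul_natDegree le_rfl] at h
  simpa using (mul_eq_zero.1 h).resolve_right (hP.norm_ne_zero _)

/-! ### Admissibility of the Pearson equation -/

theorem SatisfiesPearson.apply {c4 c5 c6 : ℂ} {u : Polynomial ℂ →ₗ[ℂ] ℂ} {φ ψ : Polynomial ℂ}
    (h : SatisfiesPearson c4 c5 c6 u φ ψ) (f : Polynomial ℂ) :
    u (φ * xDeriv c4 c5 c6 f + ψ * xAverage c4 c5 c6 f) = 0 := by
  have := LinearMap.congr_fun h.pearson f
  simp only [functionalDeriv, functionalAverage, polyMulFunctional, LinearMap.neg_apply,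
    LinearMap.comp_apply, LinearMap.mulLeft_apply] at this
  rw [map_add]
  linear_combination -this

/-- Symmetry of L = φD² + ψSD: the Pearson equation is tested on the Casoratian of f and g. -/
theorem SatisfiesPearson.apply_mul_comm {c4 c5 c6 : ℂ} {u : Polynomial ℂ →ₗ[ℂ] ℂ}
    {φ ψ : Polynomial ℂ} (h : SatisfiesPearson c4 c5 c6 u φ ψ) (f g : Polynomial ℂ) :
    u (f * (φ * xDeriv c4 c5 c6 (xDeriv c4 c5 c6 g) + ψ * xAverage c4 c5 c6 (xDeriv c4 c5 c6 g)))
      = u (g * (φ * xDeriv c4 c5 c6 (xDeriv c4 c5 c6 f)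
        + ψ * xAverage c4 c5 c6 (xDeriv c4 c5 c6 f))) := by
  have hW := h.apply (xCasoratian c4 c5 c6 f g)
  rw [xDeriv_xCasoratian, xAverage_xCasoratian] at hW
  generalize xDeriv c4 c5 c6 (xDeriv c4 c5 c6 f) = f₂ at hW ⊢
  generalize xDeriv c4 c5 c6 (xDeriv c4 c5 c6 g) = g₂ at hW ⊢
  generalize xAverage c4 c5 c6 (xDeriv c4 c5 c6 f) = f₁ at hW ⊢
  generalize xAverage c4 c5 c6 (xDeriv c4 c5 c6 g) = g₁ at hW ⊢
  have hW' : φ * (f * g₂ - g * f₂) + ψ * (f * g₁ - g * f₁) =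
      f * (φ * g₂ + ψ * g₁) - g * (φ * f₂ + ψ * f₁) := by ring
  rwa [hW', map_sub, sub_eq_zero] at hW

theorem natDegree_pearson_le (c4 c5 c6 : ℂ) {φ ψ h : Polynomial ℂ} {n : ℕ}
    (hφ : φ.natDegree ≤ 2) (hψ : ψ.natDegree ≤ 1) (hh : h.natDegree ≤ n) :
    (φ * xDeriv c4 c5 c6 h + ψ * xAverage c4 c5 c6 h).natDegree ≤ n + 1 ∧
    (φ * xDeriv c4 c5 c6 h + ψ * xAverage c4 c5 c6 h).coeff (n + 1) =
      (n * φ.coeff 2 + ψ.coeff 1) * h.coeff n := by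
  have hS := natDegree_xAverage_le c4 c5 c6 hh
  have hψS : (ψ * xAverage c4 c5 c6 h).natDegree ≤ n + 1 := by
    rw [add_comm]; exact Polynomial.natDegree_mul_le_of_le hψ hS
  have hψc : (ψ * xAverage c4 c5 c6 h).coeff (n + 1) = ψ.coeff 1 * h.coeff n := by
    rw [add_comm n 1, Polynomial.coeff_mul_add_eq_of_natDegree_le hψ hS, coeff_xAverage c4 c5 c6 hh]
  rcases n with _ | n
  · have hD : xDeriv c4 c5 c6 h = 0 :=
      Polynomial.ext fun k => coeff_xDeriv_eq_zero c4 c5 c6 hh (Nat.zero_le k)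
    rw [hD, mul_zero, zero_add]
    exact ⟨hψS, by simpa using hψc⟩
  · have hD := natDegree_xDeriv_le c4 c5 c6 hh
    have hφD : (φ * xDeriv c4 c5 c6 h).natDegree ≤ n + 1 + 1 := by
      rw [show n + 1 + 1 = 2 + n by ring]; exact Polynomial.natDegree_mul_le_of_le hφ hD
    refine ⟨Polynomial.natDegree_add_le_of_degree_le hφD hψS, ?_⟩
    rw [Polynomial.coeff_add, hψc, show n + 1 + 1 = 2 + n by ring,
      Polynomial.coeff_mul_add_eq_of_natDegree_le hφ hD, coeff_xDeriv c4 c5 c6 hh]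
    push_cast
    ring

theorem SatisfiesPearson.coeff_psi_ne_zero {c4 c5 c6 : ℂ} {u : Polynomial ℂ →ₗ[ℂ] ℂ}
    {P : ℕ → Polynomial ℂ} {φ ψ : Polynomial ℂ} (hP : IsMonicOPS u P)
    (h : SatisfiesPearson c4 c5 c6 u φ ψ) : ψ.coeff 1 ≠ 0 := by
  intro h1
  have hψC : ψ = Polynomial.C (ψ.coeff 0) := by
    have := Polynomial.eq_X_add_C_of_natDegree_le_one h.degree_psi
    rwa [h1, Polynomial.C_0, zero_mul, zero_add] at this
  -- As ψ is constant, constant tests suffice, and on these D vanishes and S is the identity.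
  have hψ0 : ψ = 0 := by
    refine hP.eq_zero_of_forall fun f hf => ?_
    rw [hψC, Polynomial.natDegree_C] at hf
    have h0 := h.apply f
    rw [Polynomial.eq_C_of_natDegree_le_zero hf] at h0 ⊢
    have hS : xAverage c4 c5 c6 (Polynomial.C (f.coeff 0)) = Polynomial.C (f.coeff 0) := by
      have := Polynomial.eq_C_of_natDegree_le_zero (natDegree_xAverage_le c4 c5 c6
        (Polynomial.natDegree_C (f.coeff 0)).le)
      rwa [coeff_xAverage c4 c5 c6 (Polynomial.natDegree_C _).le, Polynomial.coeff_C_zero] at this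
    have hD : xDeriv c4 c5 c6 (Polynomial.C (f.coeff 0)) = 0 := Polynomial.ext fun k =>
      coeff_xDeriv_eq_zero c4 c5 c6 (Polynomial.natDegree_C _).le (Nat.zero_le k)
    rwa [hS, hD, mul_zero, zero_add] at h0
  have hφ0 : φ = 0 := by
    refine hP.eq_zero_of_forall fun f _ => ?_
    obtain ⟨g, rfl⟩ := xDeriv_surjective c4 c5 c6 f
    simpa [hψ0] using h.apply g
  exact h.nontrivial.elim (· hφ0) (· hψ0)

theorem SatisfiesPearson.dSeq_ne_zero {c4 c5 c6 : ℂ} {u : Polynomial ℂ →ₗ[ℂ] ℂ}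
    {P : ℕ → Polynomial ℂ} {φ ψ : Polynomial ℂ} (hP : IsMonicOPS u P)
    (h : SatisfiesPearson c4 c5 c6 u φ ψ) (n : ℕ) :
    dSeq (φ.coeff 2) (ψ.coeff 1) n ≠ 0 := by
  intro hd
  have hψ1 := h.coeff_psi_ne_zero hP
  have hd' : (n : ℂ) * φ.coeff 2 + ψ.coeff 1 = 0 := by rw [← hd, dSeq]; ring
  have hφ2 : φ.coeff 2 ≠ 0 := by
    intro h0
    rw [h0, mul_zero, zero_add] at hd'
    exact hψ1 hd'
  have hM (f : Polynomial ℂ) (k : ℕ) (hf : f.natDegree ≤ k + 1) :=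
    natDegree_pearson_le c4 c5 c6 h.degree_phi h.degree_psi (natDegree_xDeriv_le c4 c5 c6 hf)
  set g := xDeriv c4 c5 c6 (P (n + 1)) with hg
  have hPn : (P (n + 1)).coeff (n + 1) = 1 := by
    simpa [hP.natDegree_eq] using (hP.monic (n + 1)).coeff_natDegree
  have hgd : g.natDegree ≤ n := natDegree_xDeriv_le c4 c5 c6 (hP.natDegree_eq _).le
  have hgc : g.coeff n = n + 1 := by
    rw [hg, coeff_xDeriv c4 c5 c6 (hP.natDegree_eq _).le, hPn, mul_one]
  have hSg : xAverage c4 c5 c6 g ≠ 0 := by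
    intro h0
    have := coeff_xAverage c4 c5 c6 hgd
    rw [h0, hgc, Polynomial.coeff_zero] at this
    exact Nat.cast_add_one_ne_zero n this.symm
  -- the eigenvalue of `P (n + 1)` vanishes
  have hLg : φ * xDeriv c4 c5 c6 g + ψ * xAverage c4 c5 c6 g = 0 := by
    refine hP.eq_zero_of_forall fun f hf => ?_
    have hf' : f.natDegree ≤ n + 1 := hf.trans (hM _ n (hP.natDegree_eq _).le).1
    rw [mul_comm, h.apply_mul_comm, mul_comm, hP.apply_mul_natDegree (hM f n hf').1,
      (hM f n hf').2, hd', zero_mul, zero_mul]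
  -- Testing on g·k and expanding by the product rules, the terms with Sk cancel by `hLg`; the
  -- cofactor of Dk remains, and Dk is arbitrary.
  have hLg' : φ * xAverage c4 c5 c6 g + latticeU c4 c5 c6 * ψ * xDeriv c4 c5 c6 g = 0 := by
    refine hP.eq_zero_of_forall fun f _ => ?_
    obtain ⟨k, rfl⟩ := xDeriv_surjective c4 c5 c6 f
    have := h.apply (g * k)
    rw [xDeriv_mul, xAverage_mul] at this
    rw [← this]
    congr 1
    linear_combination -xAverage c4 c5 c6 k * hLg
  -- The two relations form a homogeneous linear system in Dg and Sg, whose determinant must kill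
  -- Sg.
  have hdet : (φ * φ - latticeU c4 c5 c6 * (ψ * ψ)) * xAverage c4 c5 c6 g = 0 := by
    linear_combination φ * hLg' - latticeU c4 c5 c6 * ψ * hLg
  have hsq := (mul_eq_zero.1 hdet).resolve_right hSg
  have h4 := congrArg (fun t => Polynomial.coeff t (2 + 2)) hsq
  have hU : (latticeU c4 c5 c6 * (ψ * ψ)).natDegree < 2 + 2 := by
    have h1 : (latticeU c4 c5 c6).natDegree ≤ 1 := by unfold latticeU; compute_degree
    have := Polynomial.natDegree_mul_le_of_le h1
      (Polynomial.natDegree_mul_le_of_le h.degree_psi h.degree_psi)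
    omega
  simp only [Polynomial.coeff_sub, Polynomial.coeff_eq_zero_of_natDegree_lt hU,
    Polynomial.coeff_mul_add_eq_of_natDegree_le h.degree_phi h.degree_phi, Polynomial.coeff_zero,
    sub_zero, mul_self_eq_zero] at h4
  exact hφ2 h4

/-! ### The first recurrence coefficients -/

/-- The equations for B₀, B₁, C₁ give e, b, c in terms of a; the one for C₂ then becomes linear in
a. The hypotheses on `dSeq` serve the converse, since a solution carries its own nonvanishing. -/
theorem firstRecurrenceSystem_iff {c4 c5 c6 B0 B1 C1 C2 : ℂ} (hC2 : C2 ≠ 0)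
    (h1 : dSeq (fraka c4 c5 c6 B0 B1 C1 C2) 1 1 ≠ 0)
    (h2 : dSeq (fraka c4 c5 c6 B0 B1 C1 C2) 1 2 ≠ 0)
    (h3 : dSeq (fraka c4 c5 c6 B0 B1 C1 C2) 1 3 ≠ 0) (a b c e : ℂ) :
    FirstRecurrenceSystem c4 c5 c6 a b c 1 e B0 B1 C1 C2 ↔
      e = -B0 ∧ a = fraka c4 c5 c6 B0 B1 C1 C2 ∧
      b = -fraka c4 c5 c6 B0 B1 C1 C2 * B0 - frakb c4 c5 c6 B0 B1 C1 C2 ∧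
      c = frakb c4 c5 c6 B0 B1 C1 C2 * B0 - (fraka c4 c5 c6 B0 B1 C1 C2 + 1) * C1 := by
  set α := fraka c4 c5 c6 B0 B1 C1 C2 with hα
  have hαC : 6 * C2 * (α + 1 / 3) = (B1 - B0) ^ 2 - 2 * c4 * (B0 + B1 - c4 / 2)
      + 4 * (C1 + c4 * c6) - c5 ^ 2 := by
    rw [hα, fraka, latticeBeta]
    field_simp
    ring
  have hβ : frakb c4 c5 c6 B0 B1 C1 C2 = (α + 1) * B1 + c4 / 2 - (B0 + B1) / 2 := by
    rw [frakb, ← hα, latticeBeta]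
    ring
  rw [hβ]
  -- From here α is known only through its linear equation `hαC`.
  clear_value α
  constructor
  · rintro ⟨hd, hB0, hB1, hC1, hC2'⟩
    have d1 : a + 1 ≠ 0 := by simpa [dSeq] using hd 1 (by norm_num)
    have d2 : a * 2 + 1 ≠ 0 := by simpa [dSeq] using hd 2 (by norm_num)
    have d2' : 2 * a + 1 ≠ 0 := by rwa [mul_comm]
    have d3 : a * 3 + 1 ≠ 0 := by simpa [dSeq] using hd 3 (by norm_num)
    simp only [eSeq, dSeq, phiBracket, Nat.cast_zero, Nat.cast_one, Nat.cast_ofNat, mul_zero,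
      mul_one, zero_add, add_zero, div_one, one_pow, zero_mul, zero_div, sub_zero, ne_eq,
      OfNat.ofNat_ne_zero, not_false_eq_true, zero_pow] at hB0 hB1 hC1 hC2'
    obtain rfl : e = -B0 := by linear_combination hB0
    have hb : b = -a * B0 - ((a + 1) * B1 + c4 / 2 - (B0 + B1) / 2) := by
      field_simp at hB1
      linear_combination hB1 / 2
    have hc : c = ((a + 1) * B1 + c4 / 2 - (B0 + B1) / 2) * B0 - (a + 1) * C1 := by
      rw [hb] at hC1
      field_simp at hC1
      linear_combination hC1 / 2
    -- The argument of φ^{[1]} does not depend on a.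
    have hz : -(c4 / 4) - (b + -B0 + 1 / 2 * c4) / (a * 2 + 1) = -(c4 / 4) + (B0 + B1) / 2 := by
      rw [hb]
      field_simp
      ring
    rw [hz, hb, hc] at hC2'
    -- At this point φ^{[1]} contains the factor d₁ = a + 1; cancelling it leaves the equation that
    -- defines α.
    have hC2a : (a + 1) * (6 * C2 * (a + 1 / 3)) = (a + 1) * ((B1 - B0) ^ 2
        - 2 * c4 * (B0 + B1 - c4 / 2) + 4 * (C1 + c4 * c6) - c5 ^ 2) := by
      field_simp at hC2'
      linear_combination hC2' / 16
    have hC2b := mul_left_cancel₀ d1 hC2a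
    obtain rfl : a = α := by
      have := mul_left_cancel₀ (mul_ne_zero (by norm_num) hC2) (hC2b.trans hαC.symm)
      exact add_right_cancel this
    exact ⟨rfl, rfl, hb, hc⟩
  · rintro ⟨rfl, rfl, hb, hc⟩
    have d1 : a + 1 ≠ 0 := by simpa [dSeq] using h1
    have d2 : a * 2 + 1 ≠ 0 := by simpa [dSeq] using h2
    have d2' : 2 * a + 1 ≠ 0 := by rwa [mul_comm]
    have d3 : a * 3 + 1 ≠ 0 := by simpa [dSeq] using h3
    have hz : -(c4 / 4) - (b + -B0 + 1 / 2 * c4) / (a * 2 + 1) = -(c4 / 4) + (B0 + B1) / 2 := by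
      rw [hb]
      field_simp
      ring
    refine ⟨fun n hn => ?_, ?_, ?_, ?_, ?_⟩
    · interval_cases n
      · simp [dSeq]
      · exact h1
      · exact h2
      · exact h3
    all_goals
      simp only [eSeq, dSeq, phiBracket, Nat.cast_zero, Nat.cast_one, Nat.cast_ofNat, mul_zero,
        mul_one, zero_add, add_zero, div_one, one_pow, zero_mul, zero_div, sub_zero, neg_neg,
        ne_eq, OfNat.ofNat_ne_zero, not_false_eq_true, zero_pow]
    · rw [hb]
      field_simp
      ring
    · rw [hc, hb]
      field_simp
      ring
    · rw [hz, hb, hc]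
      field_simp
      linear_combination 16 * (a + 1) * hαC

/-! ### Moments, and the Pearson equation on 1, z, z², z³ -/

theorem IsMonicOPS.apply_one_ne_zero {u : Polynomial ℂ →ₗ[ℂ] ℂ} {P : ℕ → Polynomial ℂ}
    (hP : IsMonicOPS u P) : u 1 ≠ 0 := by
  have h0 : P 0 = 1 := Polynomial.eq_one_of_monic_natDegree_zero (hP.monic 0) (hP.natDegree_eq 0)
  simpa [h0] using hP.norm_ne_zero 0

theorem IsMonicOPS.apply_sq_succ {u : Polynomial ℂ →ₗ[ℂ] ℂ} {P : ℕ → Polynomial ℂ} {B C : ℕ → ℂ}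
    (hP : IsMonicOPS u P) (hBC : HasRecurrenceCoeffs P B C) (n : ℕ) :
    u (P (n + 1) * P (n + 1)) = C (n + 1) * u (P n * P n) := by
  have hX : (Polynomial.X * P n).natDegree ≤ n + 1 := by
    rw [add_comm]
    exact Polynomial.natDegree_mul_le_of_le Polynomial.natDegree_X_le (hP.natDegree_eq n).le
  have hXc : (Polynomial.X * P n).coeff (n + 1) = 1 := by
    rw [Polynomial.coeff_X_mul]
    simpa [hP.natDegree_eq] using (hP.monic n).coeff_natDegree
  have h1 := hP.apply_mul_natDegree hX
  rw [hXc, one_mul] at h1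
  have h2 := hP.orthogonal (n + 2) n (by omega)
  have h3 := hP.orthogonal (n + 1) n (by omega)
  have h4 : P (n + 2) * P n = Polynomial.X * P n * P (n + 1) - B (n + 1) • (P (n + 1) * P n)
      - C (n + 1) • (P n * P n) := by
    rw [hBC.step, Polynomial.smul_eq_C_mul, Polynomial.smul_eq_C_mul]
    ring
  rw [h4, map_sub, map_sub, map_smul, map_smul, h3, h1, smul_zero, sub_zero, smul_eq_mul] at h2
  linear_combination h2

theorem IsMonicOPS.recurrence_coeff_ne_zero {u : Polynomial ℂ →ₗ[ℂ] ℂ} {P : ℕ → Polynomial ℂ}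
    {B C : ℕ → ℂ} (hP : IsMonicOPS u P) (hBC : HasRecurrenceCoeffs P B C) (n : ℕ) :
    C (n + 1) ≠ 0 := by
  have h := hP.norm_ne_zero (n + 1)
  rw [hP.apply_sq_succ hBC] at h
  exact left_ne_zero_of_mul h

/-- The first moments in terms of the recurrence coefficients. -/
theorem IsMonicOPS.moments {u : Polynomial ℂ →ₗ[ℂ] ℂ} {P : ℕ → Polynomial ℂ}
    {B C : ℕ → ℂ} (hP : IsMonicOPS u P) (hBC : HasRecurrenceCoeffs P B C) :
    u Polynomial.X = B 0 * u 1 ∧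
    u (Polynomial.X ^ 2) = (C 1 + B 0 ^ 2) * u 1 ∧
    u (Polynomial.X ^ 3) = (B 0 ^ 3 + C 1 * (2 * B 0 + B 1)) * u 1 ∧
    u (Polynomial.X ^ 4) = (C 2 * C 1 + (B 0 + B 1) * (B 0 ^ 3 + C 1 * (2 * B 0 + B 1))
      - (B 0 * B 1 - C 1) * (C 1 + B 0 ^ 2)) * u 1 := by
  have hP2 := hBC.step 0
  simp only [zero_add, hBC.one, hBC.zero] at hP2
  have n1 := hP.apply_sq_succ hBC 0
  have n2 := hP.apply_sq_succ hBC 1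
  have o1 := hP.orthogonal 1 0 (by norm_num)
  have o2 := hP.orthogonal 2 1 (by norm_num)
  simp only [zero_add, Nat.reduceAdd] at n1 n2
  rw [n1] at n2
  have hsq : P 1 * P 1 = Polynomial.X ^ 2 - (2 * B 0) • Polynomial.X + B 0 ^ 2 • 1 := by
    simp only [hBC.one, Polynomial.smul_eq_C_mul, map_mul, map_pow, map_ofNat]
    ring
  have h10 : P 1 * P 0 = Polynomial.X - B 0 • 1 := by
    simp only [hBC.one, hBC.zero, Polynomial.smul_eq_C_mul, mul_one]
  have h21 : P 2 * P 1 = Polynomial.X ^ 3 - (2 * B 0 + B 1) • Polynomial.X ^ 2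
      + (B 0 ^ 2 + 2 * B 0 * B 1 - C 1) • Polynomial.X + (C 1 * B 0 - B 0 ^ 2 * B 1) • 1 := by
    simp only [hBC.one, hP2, Polynomial.smul_eq_C_mul, map_mul, map_pow, map_ofNat, map_add,
      map_sub]
    ring
  have h22 : P 2 * P 2 = Polynomial.X ^ 4 - (2 * (B 0 + B 1)) • Polynomial.X ^ 3
      + ((B 0 + B 1) ^ 2 + 2 * (B 0 * B 1 - C 1)) • Polynomial.X ^ 2
      - (2 * (B 0 + B 1) * (B 0 * B 1 - C 1)) • Polynomial.X + (B 0 * B 1 - C 1) ^ 2 • 1 := by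
    simp only [hP2, Polynomial.smul_eq_C_mul, map_mul, map_pow, map_ofNat, map_add, map_sub]
    ring
  rw [hsq, hBC.zero, mul_one] at n1
  rw [h22, hBC.zero, mul_one] at n2
  rw [h10] at o1
  rw [h21] at o2
  simp only [map_add, map_sub, map_smul, smul_eq_mul] at n1 n2 o1 o2
  -- Each of u(P₁P₀) = 0, the norm of P₁, u(P₂P₁) = 0 and the norm of P₂ brings in exactly one new
  -- moment.
  have m1 : u Polynomial.X = B 0 * u 1 := by linear_combination o1
  rw [m1] at n1 n2 o2
  have m2 : u (Polynomial.X ^ 2) = (C 1 + B 0 ^ 2) * u 1 := by linear_combination n1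
  rw [m2] at n2 o2
  have m3 : u (Polynomial.X ^ 3) = (B 0 ^ 3 + C 1 * (2 * B 0 + B 1)) * u 1 := by
    linear_combination o2
  rw [m3] at n2
  exact ⟨m1, m2, m3, by linear_combination n2⟩

theorem SatisfiesPearson.coeffs_eq {c4 c5 c6 : ℂ} {u : Polynomial ℂ →ₗ[ℂ] ℂ}
    {P : ℕ → Polynomial ℂ} {B C : ℕ → ℂ} {φ ψ : Polynomial ℂ} (hP : IsMonicOPS u P)
    (hBC : HasRecurrenceCoeffs P B C) (h : SatisfiesPearson c4 c5 c6 u φ ψ)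
    (hd : ψ.coeff 1 = 1) :
    ψ.coeff 0 = -B 0 ∧
    φ.coeff 2 = fraka c4 c5 c6 (B 0) (B 1) (C 1) (C 2) ∧
    φ.coeff 1 = -fraka c4 c5 c6 (B 0) (B 1) (C 1) (C 2) * B 0
      - frakb c4 c5 c6 (B 0) (B 1) (C 1) (C 2) ∧
    φ.coeff 0 = frakb c4 c5 c6 (B 0) (B 1) (C 1) (C 2) * B 0
      - (fraka c4 c5 c6 (B 0) (B 1) (C 1) (C 2) + 1) * C 1 := by
  have u0 := hP.apply_one_ne_zero
  have hC1 := hP.recurrence_coeff_ne_zero hBC 0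
  have hC2 := hP.recurrence_coeff_ne_zero hBC 1
  obtain ⟨m1, m2, m3, m4⟩ := hP.moments hBC
  simp only [zero_add, Nat.reduceAdd] at hC1 hC2
  have hφ : φ = φ.coeff 2 • Polynomial.X ^ 2 + φ.coeff 1 • Polynomial.X + φ.coeff 0 • 1 := by
    conv_lhs => rw [φ.as_sum_range_C_mul_X_pow' (n := 3) (by have := h.degree_phi; omega)]
    simp only [Finset.sum_range_succ, Finset.sum_range_zero, Polynomial.smul_eq_C_mul]
    ring
  have hψ : ψ = Polynomial.X + ψ.coeff 0 • 1 := by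
    have := Polynomial.eq_X_add_C_of_natDegree_le_one h.degree_psi
    rwa [hd, Polynomial.C_1, one_mul, ← mul_one (Polynomial.C _), ← Polynomial.smul_eq_C_mul]
      at this
  generalize φ.coeff 2 = a at *
  generalize φ.coeff 1 = b at *
  generalize φ.coeff 0 = c at *
  generalize ψ.coeff 0 = e at *
  have r (n : ℕ) : u (φ * (xPair c4 c5 c6 n).1 + ψ * (xPair c4 c5 c6 n).2) = 0 := by
    rw [← xDeriv_monomial, ← xAverage_monomial]
    exact h.apply _
  have r0 := r 0
  have r1 := r 1
  have r2 := r 2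
  have r3 := r 3
  have q0 : φ * (xPair c4 c5 c6 0).1 + ψ * (xPair c4 c5 c6 0).2 = Polynomial.X + e • 1 := by
    rw [hψ]
    simp [xPair]
  rw [q0] at r0
  simp only [map_add, map_smul, smul_eq_mul, m1] at r0
  obtain rfl : e = -B 0 := mul_right_cancel₀ u0 (by linear_combination r0)
  have q1 : φ * (xPair c4 c5 c6 1).1 + ψ * (xPair c4 c5 c6 1).2 =
      (a + 1) • Polynomial.X ^ 2 + (b + c4 / 4 - B 0) • Polynomial.X
        + (c - B 0 * (c4 / 4)) • 1 := by
    rw [hφ, hψ]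
    simp only [xPair, latticeU, latticeBeta, Polynomial.smul_eq_C_mul, map_mul, map_add, map_sub,
      map_neg, map_one]
    ring
  rw [q1] at r1
  simp only [map_add, map_smul, smul_eq_mul, m1, m2] at r1
  have R1 : (a + 1) * (C 1 + B 0 ^ 2) + (b + c4 / 4 - B 0) * B 0 + (c - B 0 * (c4 / 4)) = 0 :=
    mul_right_cancel₀ u0 (by linear_combination r1)
  -- This leaves β as the only lattice atom besides κ when `ring` expands the pairs.
  have hβ : Polynomial.C c4 = 4 * Polynomial.C (c4 / 4) := by
    rw [← map_ofNat Polynomial.C 4, ← map_mul]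
    congr 1
    ring
  set β := c4 / 4 with hβ'
  set κ := c5 ^ 2 / 4 - c4 * c6 with hκ
  have q2 : φ * (xPair c4 c5 c6 2).1 + ψ * (xPair c4 c5 c6 2).2 =
      (2 * a + 1) • Polynomial.X ^ 3 + (2 * b + 2 * a * β + 6 * β - B 0) • Polynomial.X ^ 2
        + (2 * c + 2 * b * β + β ^ 2 + κ - 6 * β * B 0) • Polynomial.X
        + (2 * c * β - B 0 * (β ^ 2 + κ)) • 1 := by
    rw [hφ, hψ]
    simp only [xPair, latticeU, latticeBeta, ← hβ', ← hκ, hβ, Polynomial.smul_eq_C_mul, map_mul,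
      map_add, map_sub, map_neg, map_one, map_pow, map_ofNat]
    ring
  have q3 : φ * (xPair c4 c5 c6 3).1 + ψ * (xPair c4 c5 c6 3).2 =
      (3 * a + 1) • Polynomial.X ^ 4 + (3 * b + 10 * a * β + 15 * β - B 0) • Polynomial.X ^ 3
        + (3 * c + 10 * b * β + a * (3 * β ^ 2 + κ) + 15 * β ^ 2 + 3 * κ - 15 * β * B 0)
          • Polynomial.X ^ 2
        + (10 * c * β + b * (3 * β ^ 2 + κ) + β ^ 3 + 3 * β * κ - (15 * β ^ 2 + 3 * κ) * B 0)
          • Polynomial.X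
        + (c * (3 * β ^ 2 + κ) - B 0 * (β ^ 3 + 3 * β * κ)) • 1 := by
    rw [hφ, hψ]
    simp only [xPair, latticeU, latticeBeta, ← hβ', ← hκ, hβ, Polynomial.smul_eq_C_mul, map_mul,
      map_add, map_sub, map_neg, map_one, map_pow, map_ofNat]
    ring
  rw [q2] at r2
  rw [q3] at r3
  simp only [map_add, map_smul, smul_eq_mul, m1, m2, m3, m4] at r2 r3
  -- Subtracting 2(B₀ + β) times `R1` eliminates c, and the remainder is divisible by 2C₁.
  have hb : b = -a * (B 0 + B 1) + (B 0 - B 1) / 2 - 2 * β := by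
    refine mul_left_cancel₀ (mul_ne_zero (mul_ne_zero two_ne_zero hC1) u0) ?_
    linear_combination r2 - 2 * (B 0 + β) * u 1 * R1
  obtain rfl : c = -(a + 1) * (C 1 + B 0 ^ 2) - (b + β - B 0) * B 0 + B 0 * β := by
    linear_combination R1
  subst hb
  -- With b and c substituted, the equation for z³ is divisible by C₁ and linear in a.
  have ha : 6 * C 2 * (a + 1 / 3) = (B 1 - B 0) ^ 2 - 8 * β * (B 0 + B 1 - 2 * β)
      + 4 * (C 1 + 4 * β * c6) - c5 ^ 2 := by
    refine mul_left_cancel₀ (mul_ne_zero hC1 u0) ?_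
    have hc4 : c4 = 4 * β := by rw [hβ']; ring
    rw [hκ, hc4] at r3
    linear_combination 2 * r3
  have ha' : a = fraka c4 c5 c6 (B 0) (B 1) (C 1) (C 2) := by
    rw [fraka, latticeBeta, ← hβ']
    field_simp
    linear_combination 3 * ha
  rw [frakb, ← ha', latticeBeta, ← hβ']
  exact ⟨rfl, rfl, by ring, by ring⟩

theorem mainTheorem2 (c4 c5 c6 : ℂ) (u : Polynomial ℂ →ₗ[ℂ] ℂ) (P : ℕ → Polynomial ℂ)
    (B C : ℕ → ℂ) (φ ψ : Polynomial ℂ)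
    (hP : IsMonicOPS u P) (hBC : HasRecurrenceCoeffs P B C)
    (hφψ : SatisfiesPearson c4 c5 c6 u φ ψ) :
    ψ.coeff 1 ≠ 0 ∧ C 1 ≠ 0 ∧ C 2 ≠ 0 ∧
    (ψ.coeff 1 = 1 →
      ψ = Polynomial.X - Polynomial.C (B 0) ∧
      φ = Polynomial.C (fraka c4 c5 c6 (B 0) (B 1) (C 1) (C 2)) * Polynomial.X ^ 2
        + Polynomial.C (-fraka c4 c5 c6 (B 0) (B 1) (C 1) (C 2) * B 0
            - frakb c4 c5 c6 (B 0) (B 1) (C 1) (C 2)) * Polynomial.X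
        + Polynomial.C (frakb c4 c5 c6 (B 0) (B 1) (C 1) (C 2) * B 0
            - (fraka c4 c5 c6 (B 0) (B 1) (C 1) (C 2) + 1) * C 1) ∧
      ∀ a b c e : ℂ,
        FirstRecurrenceSystem c4 c5 c6 a b c 1 e (B 0) (B 1) (C 1) (C 2) ↔
          e = -B 0 ∧
          a = fraka c4 c5 c6 (B 0) (B 1) (C 1) (C 2) ∧
          b = -fraka c4 c5 c6 (B 0) (B 1) (C 1) (C 2) * B 0
            - frakb c4 c5 c6 (B 0) (B 1) (C 1) (C 2) ∧
          c = frakb c4 c5 c6 (B 0) (B 1) (C 1) (C 2) * B 0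
            - (fraka c4 c5 c6 (B 0) (B 1) (C 1) (C 2) + 1) * C 1) := by
  refine ⟨hφψ.coeff_psi_ne_zero hP, hP.recurrence_coeff_ne_zero hBC 0,
    hP.recurrence_coeff_ne_zero hBC 1, fun hd => ?_⟩
  obtain ⟨he, ha, hb, hc⟩ := hφψ.coeffs_eq hP hBC hd
  have hdn := hφψ.dSeq_ne_zero hP
  rw [hd, ha] at hdn
  refine ⟨?_, ?_, firstRecurrenceSystem_iff (hP.recurrence_coeff_ne_zero hBC 1)
    (hdn 1) (hdn 2) (hdn 3)⟩
  · rw [Polynomial.eq_X_add_C_of_natDegree_le_one hφψ.degree_psi, hd, he]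
    simp [sub_eq_add_neg]
  · rw [← hb, ← hc, ← ha]
    conv_lhs => rw [φ.as_sum_range_C_mul_X_pow' (n := 3) (by have := hφψ.degree_phi; omega)]
    simp only [Finset.sum_range_succ, Finset.sum_range_zero]
    ring
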